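/- For $n\ge 0$ let $a_n$ be the number of permutations of $\{1,\dots,n\}$ that avoid both patterns $4123$ and $1342$ (a permutation contains a pattern if some subsequence of its one-line notation is in the same relative order as the pattern, and avoids it otherwise), and let $\mathcal P_3(z)=\sum_{n\ge 0}a_nz^n$ be the generating function of the permutation class $Av(4123,1342)$. Then, as formal power series, $$\mathcal P_3(z)=1+\frac{z(1-z)(1-2z)\left(1-7z+17z^2-16z^3+4z^4+(1-3z+3z^2)\sqrt{1-4z}\right)}{2-22z+96z^2-220z^3+282z^4-196z^5+64z^6-8z^7},$$ where $\sqrt{1-4z}$ denotes the power series with constant term $1$ whose square is $1-4z$. -/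

import Mathlib

open scoped PowerSeries

namespace PermClass

/-- The permutation `σ` of length `n` contains the pattern `p` of length `k`: some subsequence
`σ (f 0), …, σ (f (k - 1))` (with `f` strictly increasing) is in the same relative order
as `p 0, …, p (k - 1)`. -/
def Contains {n k : ℕ} (σ : Equiv.Perm (Fin n)) (p : Equiv.Perm (Fin k)) : Prop :=
  ∃ f : Fin k → Fin n, StrictMono f ∧ ∀ i j : Fin k, σ (f i) < σ (f j) ↔ p i < p j

/-- The permutation class `Av(B)`, as the set of its members of each length `n`. -/
def Av (B : Set (Σ k : ℕ, Equiv.Perm (Fin k))) (n : ℕ) : Set (Equiv.Perm (Fin n)) :=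
  {σ | ∀ p ∈ B, ¬ Contains σ p.2}

/-- The (ordinary) generating function of the permutation class `Av(B)`: the coefficient of `z ^ n`
is the number of its members of length `n` (the empty permutation included). -/
noncomputable def genFun (B : Set (Σ k : ℕ, Equiv.Perm (Fin k))) : ℚ⟦X⟧ :=
  PowerSeries.mk fun n => ((Av B n).ncard : ℚ)

/-- The pattern `4123` in one-line notation (positions and values are counted from `0` here). -/
def p4123 : Equiv.Perm (Fin 4) where
  toFun := ![3, 0, 1, 2]
  invFun := ![1, 2, 3, 0]
  left_inv := by decide
  right_inv := by decide

/-- The pattern `1342` in one-line notation (positions and values are counted from `0` here). -/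
def p1342 : Equiv.Perm (Fin 4) where
  toFun := ![0, 2, 3, 1]
  invFun := ![0, 3, 1, 2]
  left_inv := by decide
  right_inv := by decide

/-- The generating function `P₃` of `Av(4123, 1342)`. -/
noncomputable def P₃ : ℚ⟦X⟧ :=
  genFun {⟨4, p4123⟩, ⟨4, p1342⟩}

/-- `s` is the formal power series `√(1 - 4z)`: the square root of `1 - 4z` with constant
term `1`. -/
def IsSqrtOneSubFour (s : ℚ⟦X⟧) : Prop :=
  s ^ 2 = 1 - 4 * PowerSeries.X ∧ PowerSeries.constantCoeff s = 1

end PermClass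

/-!
A permutation `σ` is encoded by the list whose entry at index `v` is the reverse of the position
`σ⁻¹ v`. This turns the patterns `4123` and `1342` into `3214` and `4132`, whose largest entry sits
at an end, so the class grows by inserting a new maximum into a list `u ++ x`. The result
`u ++ N :: x` stays in the class exactly when `u` has no `321` and `x` has no `132`
(`avoids_insert_iff`). Hence the admissible sites are the cuts inside one contiguous block of the
list, its core (`IsCore`), and `IsCore.insert` tells how the core changes under an insertion.

A core is always a concatenation of two increasing runs, and all that matters for the future is a
label with two natural parameters (`Label`, `HasLabel`). The labels of the children of a node depend
only on its label (`HasLabel.sum_children`), so that the number of members of each length is read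
off a family of power series `G s` with `G s = 1 + X * ∑ G s'`, the sum being over the labels `s'`
of the children of `s` (`numDesc_eq_coeff`).

For a first run of length one, the partial sums of `G` over the second parameter satisfy linear
recurrences with constant coefficients. The power series roots of the characteristic polynomials are
the Catalan series `C` and `1 / (1 - X)`, which gives closed forms with two undetermined series; two
linear equations then fix these (`Label.closedForm_eq`). Since the system for `G` has a unique
solution, it suffices to verify the closed form. Eliminating `C` through `√(1 - 4X) = 1 - 2XC` gives
the formula (`exists_label_genFun`).
-/

namespace PermClass

open scoped List

/-! ### The generating tree on labels and its generating functions -/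

/-- The labels of the generating tree. They describe lists of the class through their core, the
block whose cuts are the admissible sites, which consists of two increasing runs; see `HasLabel`.

* `high p a`: runs of lengths `a` and `p`; a new maximum at the right end of the core keeps the
  whole core.
* `low a m`: runs of lengths `a + 1` and `m + 1`, the first one having the larger entries, and the
  part to the right of the core being smaller than the core.
* `capped a m`: the same runs, but to the right of the core there is an entry larger than the
  second run. -/
inductive Label
  | high (p a : ℕ)
  | low (a m : ℕ)
  | capped (a m : ℕ)

/-- The sum of `g` over the labels of the children of a node labelled `s`. -/
def Label.childSum {M : Type*} [AddCommMonoid M] (g : Label → M) : Label → M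
  | high p a => ∑ j ∈ Finset.range a, g (capped 0 j) + ∑ j ∈ Finset.range p, g (low 0 j) +
      g (high (p + 1) a)
  | low a m => ∑ j ∈ Finset.range (a + 1), g (low 0 j) + g (low (a + 1) m) +
      ∑ j ∈ Finset.range m, g (low 0 j) + g (high (m + 2) (a + 1))
  | capped a m => ∑ j ∈ Finset.range (a + 1), g (low 0 j) + g (capped (a + 1) m) +
      ∑ j ∈ Finset.range m, g (capped 0 j) + g (high 1 0)

/-- The Catalan generating function with rational coefficients. -/
noncomputable def catalanQ : ℚ⟦X⟧ := PowerSeries.map (Nat.castRingHom ℚ) PowerSeries.catalanSeries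

theorem X_mul_catalanQ_sq : PowerSeries.X * catalanQ ^ 2 = catalanQ - 1 := by
  have h := congrArg (PowerSeries.map (Nat.castRingHom ℚ)) PowerSeries.catalanSeries_sq_mul_X_add_one
  simp only [map_add, map_mul, map_pow, map_one, PowerSeries.map_X] at h
  unfold catalanQ
  linear_combination h

theorem constantCoeff_catalanQ : PowerSeries.constantCoeff catalanQ = 1 := by
  simp [catalanQ, ← PowerSeries.coeff_zero_eq_constantCoeff_apply, PowerSeries.coeff_map,
    PowerSeries.catalanSeries_coeff]

section Solution

variable {R : Type*} [CommRing R]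

/-- The generating functions of the subtrees of the generating tree, in terms of the Catalan series
`C`, of `y = 1 / (1 - z)` and `t = 1 / (1 - 2z)`, and of two parameters: `g` is the series of
`capped 0 0`, and `K * (1 - z) ^ 2 * C ^ 2` that of `low 0 0`. -/
def Label.closedForm (z C y t K g : R) : Label → R
  | high p a => y + K * (1 - z) * ((1 - z) * C ^ (p + 1) - 1) + g * (y ^ a - 1)
  | low a m => K * (1 - z) ^ 2 * (C ^ (m + 2) + C ^ (a + 2) - C ^ 2) + z * g * t * (y ^ a - 1)
  | capped a m => g * y ^ m + K * (1 - z) ^ 2 * (C ^ (a + 2) - C ^ 2)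

/-- The closed form solves the system of the generating tree as soon as the two parameters satisfy
the linear equations `h1` and `h2`, which come from the labels `low` and `capped`. -/
theorem Label.closedForm_eq {z C y t K g : R} (hC : z * C ^ 2 = C - 1) (hy : y * (1 - z) = 1)
    (ht : t * (1 - 2 * z) = 1)
    (h1 : y ^ 2 + K * ((1 - z) ^ 2 * C ^ 2 - 2 + z) + z ^ 2 * t * y * g = 0)
    (h2 : g = y ^ 2 + K * ((1 - z) * C ^ 2 - 1)) (s : Label) :
    s.closedForm z C y t K g = 1 + z * s.childSum (closedForm z C y t K g) := by
  have hlow : ∀ n, z * ∑ j ∈ Finset.range n, (low 0 j).closedForm z C y t K g =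
      K * (1 - z) ^ 2 * (C ^ n - 1) := by
    intro n
    induction n with
    | zero => simp
    | succ n ih =>
      rw [Finset.sum_range_succ, mul_add, ih]
      simp only [closedForm]
      linear_combination K * (1 - z) ^ 2 * C ^ n * hC
  have hcap : ∀ n, z * ∑ j ∈ Finset.range n, (capped 0 j).closedForm z C y t K g =
      g * (1 - z) * (y ^ n - 1) := by
    intro n
    induction n with
    | zero => simp
    | succ n ih =>
      rw [Finset.sum_range_succ, mul_add, ih]
      simp only [closedForm]
      linear_combination - g * y ^ n * hy
  cases s with
  | high p a =>
    simp only [childSum, mul_add, hlow, hcap]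
    simp only [closedForm]
    linear_combination hy - K * (1 - z) ^ 2 * C ^ p * hC
  | low a m =>
    simp only [childSum, mul_add, hlow]
    simp only [closedForm]
    linear_combination (- K * (1 - z) ^ 2 * (C ^ (a + 1) + C ^ m * (1 + C))) * hC - (1 - z) * h1 +
      (y + 1 + g * z ^ 2 * t - y ^ a * z * g * t) * hy + (y ^ (a + 1) * z * g - z * g) * ht
  | capped a m =>
    simp only [childSum, mul_add, hlow, hcap]
    simp only [closedForm]
    linear_combination - K * (1 - z) ^ 2 * C ^ (a + 1) * hC + (1 - z) * h2 + (y + 1) * hy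

end Solution

open PowerSeries in
/-- The system of the generating tree has a solution whose value at the root is the asserted
generating function, with `1 - 2 X C` for the square root. -/
theorem exists_label_genFun : ∃ G : Label → ℚ⟦X⟧, (∀ s, G s = 1 + X * s.childSum G) ∧
    G (.high 0 0) = 1 + X * (1 - X) * (1 - 2 * X) *
            (1 - 7 * X + 17 * X ^ 2 - 16 * X ^ 3 + 4 * X ^ 4 +
              (1 - 3 * X + 3 * X ^ 2) * (1 - 2 * X * catalanQ)) *
          (2 - 22 * X + 96 * X ^ 2 - 220 * X ^ 3 + 282 * X ^ 4 - 196 * X ^ 5 + 64 * X ^ 6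
            - 8 * X ^ 7)⁻¹ := by
  set C := catalanQ with hCdef
  have hC : X * C ^ 2 = C - 1 := X_mul_catalanQ_sq
  -- Eliminating `g` from the two linear equations leaves `K * D = y ^ 2 * (1 - 3 * X + 3 * X ^ 2)`.
  set D : ℚ⟦X⟧ := (2 - X) * (1 - X) * (1 - 2 * X) - (1 - X) ^ 3 * (1 - 2 * X) * C ^ 2 -
    X ^ 2 * (1 - X) * C ^ 2 + X ^ 2 with hD
  have hy : (1 - X : ℚ⟦X⟧)⁻¹ * (1 - X) = 1 := PowerSeries.inv_mul_cancel _ (by simp)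
  have ht : (1 - 2 * X : ℚ⟦X⟧)⁻¹ * (1 - 2 * X) = 1 := PowerSeries.inv_mul_cancel _ (by simp)
  have h2c : constantCoeff (2 : ℚ⟦X⟧) = 2 := map_ofNat _ 2
  have hDi : D⁻¹ * D = 1 := PowerSeries.inv_mul_cancel _ (by
    simp [hD, hCdef, constantCoeff_catalanQ, h2c]; norm_num)
  set den : ℚ⟦X⟧ := 2 - 22 * X + 96 * X ^ 2 - 220 * X ^ 3 + 282 * X ^ 4 - 196 * X ^ 5 + 64 * X ^ 6
            - 8 * X ^ 7 with hden
  have hdi : den⁻¹ * den = 1 := PowerSeries.inv_mul_cancel _ (by simp [hden, h2c])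
  set y : ℚ⟦X⟧ := (1 - X)⁻¹
  set t : ℚ⟦X⟧ := (1 - 2 * X)⁻¹
  set K : ℚ⟦X⟧ := y ^ 2 * (1 - 3 * X + 3 * X ^ 2) * D⁻¹ with hK
  set g : ℚ⟦X⟧ := y ^ 2 + K * ((1 - X) * C ^ 2 - 1) with hg
  have hKD : K * D = y ^ 2 * (1 - 3 * X + 3 * X ^ 2) := by
    rw [hK]; linear_combination y ^ 2 * (1 - 3 * X + 3 * X ^ 2) * hDi
  have hw : (1 - X : ℚ⟦X⟧) ≠ 0 := right_ne_zero_of_mul_eq_one hy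
  have hv : (1 - 2 * X : ℚ⟦X⟧) ≠ 0 := right_ne_zero_of_mul_eq_one ht
  have hD0 : D ≠ 0 := right_ne_zero_of_mul_eq_one hDi
  have hd0 : den ≠ 0 := right_ne_zero_of_mul_eq_one hdi
  refine ⟨Label.closedForm X C y t K g, Label.closedForm_eq hC hy ht ?_ rfl, ?_⟩
  · apply mul_left_cancel₀ hw
    apply mul_left_cancel₀ hv
    linear_combination - hKD + X ^ 2 * g * ((1 - 2 * X) * t * hy + ht)
  · set N : ℚ⟦X⟧ := X * (1 - X) * (1 - 2 * X) * (1 - 7 * X + 17 * X ^ 2 - 16 * X ^ 3 + 4 * X ^ 4 +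
      (1 - 3 * X + 3 * X ^ 2) * (1 - 2 * X * C)) with hN
    have hND : (X * D + (1 - 3 * X + 3 * X ^ 2) * ((1 - X) * C - 1)) * den = D * (1 - X) * N := by
      -- The factor `X` makes it possible to lower the degree in `C`.
      have hE : X * D = X * (2 - X) * (1 - X) * (1 - 2 * X) + X ^ 3 -
          ((1 - X) ^ 3 * (1 - 2 * X) + X ^ 2 * (1 - X)) * (C - 1) := by
        rw [hD]
        linear_combination - ((1 - X) ^ 3 * (1 - 2 * X) + X ^ 2 * (1 - X)) * hC
      rw [hN, hden]
      clear_value D C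
      linear_combination (den - (1 - X) ^ 2 * (1 - 2 * X) * (1 - 7 * X + 17 * X ^ 2 - 16 * X ^ 3 +
        4 * X ^ 4 + (1 - 3 * X + 3 * X ^ 2) * (1 - 2 * X * C))) * hE -
        2 * ((1 - X) ^ 3 * (1 - 2 * X) + X ^ 2 * (1 - X)) * (1 - X) ^ 2 * (1 - 2 * X) *
        (1 - 3 * X + 3 * X ^ 2) * hC
    simp only [Label.closedForm]
    apply mul_left_cancel₀ hw
    apply mul_left_cancel₀ hD0
    apply mul_left_cancel₀ hd0
    clear_value N den D C K y t g
    linear_combination den * D * hy + den * (1 - X) ^ 2 * ((1 - X) * C - 1) * hKD +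
      den * ((1 - X) * C - 1) * (1 - 3 * X + 3 * X ^ 2) * ((1 - X) * y + 1) * hy -
      D * (1 - X) * N * hdi + hND

/-! ### Patterns in lists and the core of a list -/

/-- The list contains the pattern `321`. -/
def Has321 (l : List ℕ) : Prop := ∃ a b c, [c, b, a] <+ l ∧ a < b ∧ b < c

/-- The list contains the pattern `132`. -/
def Has132 (l : List ℕ) : Prop := ∃ a b c, [a, c, b] <+ l ∧ a < b ∧ b < c

/-- The list avoids the patterns `3214` and `4132`. -/
def Avoids (l : List ℕ) : Prop :=
  ∀ a b c d, a < b → b < c → c < d → ¬ [c, b, a, d] <+ l ∧ ¬ [d, a, c, b] <+ l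

theorem Has321.mono {l l' : List ℕ} (h : Has321 l) (hl : l <+ l') : Has321 l' :=
  let ⟨a, b, c, hs, h⟩ := h; ⟨a, b, c, hs.trans hl, h⟩

theorem Has132.mono {l l' : List ℕ} (h : Has132 l) (hl : l <+ l') : Has132 l' :=
  let ⟨a, b, c, hs, h⟩ := h; ⟨a, b, c, hs.trans hl, h⟩

theorem sublist_insert {s u x : List ℕ} {N : ℕ} (h : s <+ u ++ N :: x) :
    s <+ u ++ x ∨ ∃ s₁ s₂, s = s₁ ++ N :: s₂ ∧ s₁ <+ u ∧ s₂ <+ x := by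
  obtain ⟨s₁, s₂, rfl, h₁, h₂⟩ := List.sublist_append_iff.1 h
  rcases List.sublist_cons_iff.1 h₂ with h₃ | ⟨r, rfl, h₃⟩
  · exact .inl (h₁.append h₃)
  · exact .inr ⟨s₁, r, rfl, h₁, h₃⟩

/-- A new maximum creates a forbidden pattern only as its `4`, that is, at the right end of a `3214`
or at the left end of a `4132`. -/
theorem avoids_insert_iff {u x : List ℕ} {N : ℕ} (hN : ∀ e ∈ u ++ x, e < N) :
    Avoids (u ++ N :: x) ↔ Avoids (u ++ x) ∧ ¬ Has321 u ∧ ¬ Has132 x := by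
  constructor
  · intro h
    have hsub : u ++ x <+ u ++ N :: x := (List.Sublist.refl u).append (List.sublist_cons_self N x)
    refine ⟨fun a b c d h₁ h₂ h₃ => ⟨fun hs => (h a b c d h₁ h₂ h₃).1 (hs.trans hsub),
      fun hs => (h a b c d h₁ h₂ h₃).2 (hs.trans hsub)⟩, ?_, ?_⟩
    · rintro ⟨a, b, c, hs, hab, hbc⟩
      refine (h a b c N hab hbc (hN c ?_)).1 (hs.append (List.singleton_sublist.2 (List.mem_cons_self)))
      exact List.mem_append_left _ (hs.subset (by simp))
    · rintro ⟨a, b, c, hs, hab, hbc⟩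
      refine (h a b c N hab hbc (hN c ?_)).2
        (List.Sublist.append (l₁ := []) (List.nil_sublist u) (hs.cons_cons N))
      exact List.mem_append_right _ (hs.subset (by simp))
  · rintro ⟨h, h3, h1⟩ a b c d hab hbc hcd
    have key : ∀ s₁ s₂ : List ℕ, s₁ <+ u → s₂ <+ x → ∀ e ∈ s₁ ++ s₂, e < N := by
      intro s₁ s₂ h₁ h₂ e he
      exact hN e ((h₁.append h₂).subset he)
    constructor
    · intro hs
      rcases sublist_insert hs with hs | ⟨s₁, s₂, he, h₁, h₂⟩
      · exact (h a b c d hab hbc hcd).1 hs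
      · have := key s₁ s₂ h₁ h₂
        rcases s₁ with _ | ⟨e₁, _ | ⟨e₂, _ | ⟨e₃, _ | ⟨e₄, s₁⟩⟩⟩⟩ <;> simp at he
        · obtain ⟨rfl, rfl⟩ := he; have := this d (by simp); omega
        · obtain ⟨rfl, rfl, rfl⟩ := he; have := this c (by simp); omega
        · obtain ⟨rfl, rfl, rfl, rfl⟩ := he; have := this c (by simp); omega
        · obtain ⟨rfl, rfl, rfl, rfl, rfl⟩ := he; exact h3 ⟨_, _, _, h₁, hab, hbc⟩
    · intro hs
      rcases sublist_insert hs with hs | ⟨s₁, s₂, he, h₁, h₂⟩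
      · exact (h a b c d hab hbc hcd).2 hs
      · have := key s₁ s₂ h₁ h₂
        rcases s₁ with _ | ⟨e₁, _ | ⟨e₂, _ | ⟨e₃, _ | ⟨e₄, s₁⟩⟩⟩⟩ <;> simp at he
        · obtain ⟨rfl, rfl⟩ := he; exact h1 ⟨_, _, _, h₂, hab, hbc⟩
        · obtain ⟨rfl, rfl, rfl⟩ := he; have := this d (by simp); omega
        · obtain ⟨rfl, rfl, rfl, rfl⟩ := he; have := this d (by simp); omega
        · obtain ⟨rfl, rfl, rfl, rfl, rfl⟩ := he; have := this d (by simp); omega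

/-- In the list `pre ++ c ++ suf`, the block `c` is the core: a cut of the list has no `321` on its
left and no `132` on its right exactly when it lies inside `c` or at one of its ends. The last two
fields say that the cuts one step further out are bad. -/
structure IsCore (pre c suf : List ℕ) : Prop where
  not321 : ¬ Has321 (pre ++ c)
  not132 : ¬ Has132 (c ++ suf)
  left : ∀ p e, pre = p ++ [e] → Has132 (e :: (c ++ suf))
  right : ∀ e q, suf = e :: q → Has321 (pre ++ c ++ [e])

theorem IsCore.active_iff {pre c suf : List ℕ} (h : IsCore pre c suf) {i : ℕ}
    (hi : i ≤ (pre ++ c ++ suf).length) :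
    ¬ Has321 ((pre ++ c ++ suf).take i) ∧ ¬ Has132 ((pre ++ c ++ suf).drop i) ↔
      pre.length ≤ i ∧ i ≤ pre.length + c.length := by
  constructor
  · rintro ⟨h3, h1⟩
    constructor
    · by_contra! hlt
      rcases List.eq_nil_or_concat' pre with rfl | ⟨p, e, rfl⟩
      · simp at hlt
      · refine h1 ((h.left p e rfl).mono ?_)
        simp at hlt
        rw [List.append_assoc, List.append_assoc, List.drop_append_of_le_length (by omega)]
        simp
    · by_contra! hlt
      rcases suf with _ | ⟨e, q⟩
      · simp at hlt hi; omega
      · refine h3 ((h.right e q rfl).mono ?_)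
        have : pre ++ c ++ e :: q = (pre ++ c ++ [e]) ++ q := by simp
        rw [this, List.take_append, List.take_of_length_le (by simp; omega)]
        simp
  · rintro ⟨h1, h2⟩
    constructor
    · intro h'
      refine h.not321 (h'.mono ?_)
      rw [List.take_append_of_le_length (by simpa using h2)]
      exact List.take_sublist _ _
    · intro h'
      refine h.not132 (h'.mono ?_)
      rw [List.append_assoc, List.drop_append, List.drop_of_length_le h1]
      exact List.drop_sublist _ _

/-- The core after the insertion of a new maximum `N` at the cut between `c₁ ++ c₂` and `c₃ ++ c₄`:
the `321` patterns with `N` as their `3` cut off `c₄`, and the `132` patterns with `N` as their `3`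
cut off `c₁`. -/
theorem IsCore.insert {pre suf c₁ c₂ c₃ c₄ : List ℕ} {N : ℕ}
    (h : IsCore pre (c₁ ++ c₂ ++ (c₃ ++ c₄)) suf)
    (hN : ∀ e ∈ pre ++ (c₁ ++ c₂ ++ (c₃ ++ c₄)) ++ suf, e < N)
    (h₃ : c₃.Pairwise (· < ·)) (h₂ : ∀ e ∈ c₂, ∀ e' ∈ c₃ ++ c₄ ++ suf, e' < e)
    (h₁ : ∀ p e, c₁ = p ++ [e] → ∃ e' ∈ c₃ ++ c₄ ++ suf, e < e')
    (h₄ : ∀ e q, c₄ = e :: q → ∃ e' ∈ c₃, e < e') :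
    IsCore (pre ++ c₁) (c₂ ++ N :: c₃) (c₄ ++ suf) where
  not321 := by
    rintro ⟨a, b, c, hs, hab, hbc⟩
    have hs' : [c, b, a] <+ (pre ++ c₁ ++ c₂) ++ N :: c₃ := by simpa using hs
    rcases sublist_insert hs' with hs | ⟨s₁, s₂, he, hs₁, hs₂⟩
    · refine h.not321 ⟨a, b, c, hs.trans ?_, hab, hbc⟩
      simp
    · rcases s₁ with _ | ⟨e₁, s₁⟩
      · simp at he
        obtain ⟨rfl, rfl⟩ := he
        have := h₃.sublist hs₂
        simp at this; omega
      · simp at he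
        obtain ⟨rfl, he⟩ := he
        have h1 : c < N := hN _ (by
          have : c ∈ pre ++ c₁ ++ c₂ := hs₁.subset (by simp)
          simp at this ⊢; tauto)
        have : N ∈ [b, a] := by rw [he]; simp
        simp at this; omega
  not132 := by
    rintro ⟨a, b, c, hs, hab, hbc⟩
    have hs' : [a, c, b] <+ c₂ ++ N :: (c₃ ++ c₄ ++ suf) := by simpa using hs
    rcases sublist_insert hs' with hs | ⟨s₁, s₂, he, hs₁, hs₂⟩
    · refine h.not132 ⟨a, b, c, hs.trans ?_, hab, hbc⟩
      simp
    · have hlt : ∀ e ∈ s₁ ++ s₂, e < N := by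
        intro e he
        have := (hs₁.append hs₂).subset he
        apply hN; simp at this ⊢; tauto
      rcases s₁ with _ | ⟨e₁, _ | ⟨e₂, _ | ⟨e₃, s₁⟩⟩⟩ <;> simp at he
      · obtain ⟨rfl, rfl⟩ := he
        have := hlt c (by simp); omega
      · obtain ⟨rfl, rfl, rfl⟩ := he
        have := h₂ a (hs₁.subset (by simp)) b (hs₂.subset (by simp))
        omega
      · obtain ⟨rfl, rfl, rfl, rfl⟩ := he
        have := hlt c (by simp); omega
  left := by
    intro p e he
    rcases List.eq_nil_or_concat' c₁ with rfl | ⟨p', e₁, rfl⟩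
    · refine (h.left p e (by simpa using he)).mono ?_
      simp
    · obtain ⟨rfl, rfl⟩ : pre ++ p' = p ∧ e₁ = e := by
        rw [← List.append_assoc] at he
        simpa using List.append_inj' he rfl
      obtain ⟨e', he', hlt⟩ := h₁ p' e₁ rfl
      refine ⟨e₁, e', N, ?_, hlt, hN _ (by simp at he' ⊢; tauto)⟩
      have : [N, e'] <+ c₂ ++ N :: (c₃ ++ c₄ ++ suf) :=
        List.sublist_append_of_sublist_right ((List.singleton_sublist.2 he').cons_cons N)
      simpa using this
  right := by
    intro e q he
    rcases c₄ with _ | ⟨e₄, q'⟩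
    · refine (h.right e q (by simpa using he)).mono ?_
      simp
    · obtain ⟨rfl, rfl⟩ : e₄ = e ∧ q' ++ suf = q := by simpa using he
      obtain ⟨e', he', hlt⟩ := h₄ e₄ q' rfl
      refine ⟨e₄, e', N, ?_, hlt, hN _ (by simp; tauto)⟩
      have : [N, e', e₄] <+ (pre ++ c₁ ++ c₂) ++ (N :: c₃ ++ [e₄]) :=
        List.sublist_append_of_sublist_right
          (((List.singleton_sublist.2 he').append (List.Sublist.refl [e₄])).cons_cons N)
      simpa using this

/-! ### Labels of lists -/

/-- Insert the length of the list, which is a new maximum if the list is a permutation of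
`0, …, n - 1`, before index `i`. -/
def insertMax (l : List ℕ) (i : ℕ) : List ℕ := l.take i ++ l.length :: l.drop i

theorem length_insertMax (l : List ℕ) (i : ℕ) : (insertMax l i).length = l.length + 1 := by
  simp [insertMax]; omega

theorem insertMax_perm (l : List ℕ) (i : ℕ) : insertMax l i ~ l.length :: l := by
  have : l.length :: (l.take i ++ l.drop i) ~ l.take i ++ l.length :: l.drop i :=
    List.perm_middle.symm
  rw [List.take_append_drop] at this
  exact this.symm

theorem insertMax_append (u x : List ℕ) :
    insertMax (u ++ x) u.length = u ++ (u ++ x).length :: x := by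
  simp [insertMax]

theorem avoids_insertMax_iff {l : List ℕ} (hl : ∀ e ∈ l, e < l.length) (i : ℕ) :
    Avoids (insertMax l i) ↔ Avoids l ∧ ¬ Has321 (l.take i) ∧ ¬ Has132 (l.drop i) := by
  unfold insertMax
  rw [avoids_insert_iff (by simpa using hl), List.take_append_drop]

/-- The list `l` has the given label, for a decomposition `l = pre ++ core ++ suf` whose core is a
concatenation of two increasing runs. In the case `high` a nonempty first run lies strictly between
the first entry of the second run and some later entry of it. -/
inductive HasLabel (l : List ℕ) : Label → Prop
  | high {pre lo hi suf : List ℕ} {p a : ℕ} (hl : l = pre ++ (lo ++ hi) ++ suf)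
      (core : IsCore pre (lo ++ hi) suf) (hi_len : hi.length = p) (lo_len : lo.length = a)
      (lo_lt : lo.Pairwise (· < ·)) (hi_lt : hi.Pairwise (· < ·))
      (suf_lt : ∀ e ∈ lo ++ hi, ∀ x ∈ suf, x < e)
      (split : lo ≠ [] → ∃ b t, hi = b :: t ∧ (∀ e ∈ lo, b < e) ∧ ∃ x ∈ t, ∀ e ∈ lo, e < x) :
      HasLabel l (.high p a)
  | low {pre lo mi suf : List ℕ} {a m : ℕ} (hl : l = pre ++ (lo ++ mi) ++ suf)
      (core : IsCore pre (lo ++ mi) suf) (lo_len : lo.length = a + 1) (mi_len : mi.length = m + 1)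
      (lo_lt : lo.Pairwise (· < ·)) (mi_lt : mi.Pairwise (· < ·))
      (mi_lt_lo : ∀ e ∈ lo, ∀ x ∈ mi, x < e)
      (suf_lt : ∀ e ∈ lo ++ mi, ∀ x ∈ suf, x < e) :
      HasLabel l (.low a m)
  | capped {pre lo mi suf : List ℕ} {a m : ℕ} (hl : l = pre ++ (lo ++ mi) ++ suf)
      (core : IsCore pre (lo ++ mi) suf) (lo_len : lo.length = a + 1) (mi_len : mi.length = m + 1)
      (lo_lt : lo.Pairwise (· < ·)) (mi_lt : mi.Pairwise (· < ·))
      (mi_lt_lo : ∀ e ∈ lo, ∀ x ∈ mi, x < e)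
      (suf_lt : ∀ e ∈ lo, ∀ x ∈ suf, x < e) (cap : ∃ x ∈ suf, ∀ e ∈ mi, e < x) :
      HasLabel l (.capped a m)

theorem HasLabel.nil : HasLabel [] (.high 0 0) :=
  .high (pre := []) (lo := []) (hi := []) (suf := []) rfl
    ⟨by simp [Has321], by simp [Has132], by simp, by simp⟩ rfl rfl (by simp) (by simp) (by simp)
    (by simp)

section Children

variable {l pre suf c₁ c₃ c₄ : List ℕ} {j : ℕ}

/-- A cut with nothing to keep on its left, whose kept right part `c₃` is larger than all that
follows it. -/
theorem HasLabel.low_of_cut (hl : l = pre ++ (c₁ ++ (c₃ ++ c₄)) ++ suf)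
    (hN : ∀ e ∈ l, e < l.length) (h : IsCore pre (c₁ ++ (c₃ ++ c₄)) suf)
    (h₃ : c₃.Pairwise (· < ·)) (hj : c₃.length = j + 1)
    (h₁ : ∀ p e, c₁ = p ++ [e] → ∃ e' ∈ c₃ ++ c₄ ++ suf, e < e')
    (h₄ : ∀ e q, c₄ = e :: q → ∃ e' ∈ c₃, e < e')
    (hs : ∀ e ∈ c₃, ∀ x ∈ c₄ ++ suf, x < e) :
    HasLabel (insertMax l (pre.length + c₁.length)) (.low 0 j) := by
  refine .low (pre := pre ++ c₁) (lo := [l.length]) (mi := c₃) (suf := c₄ ++ suf) ?_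
    (IsCore.insert (c₂ := []) (by simpa using h) (by simpa [hl] using hN) h₃ (by simp) h₁ h₄)
    rfl hj (by simp) h₃ ?_ ?_
  · have := insertMax_append (pre ++ c₁) (c₃ ++ c₄ ++ suf)
    simpa [hl] using this
  · simp only [List.mem_singleton, forall_eq]
    intro x hx
    apply hN; rw [hl]; simp; tauto
  · intro e he x hx
    rcases List.mem_append.1 he with he | he
    · rw [List.mem_singleton.1 he]
      apply hN; rw [hl]; simp at hx ⊢; tauto
    · exact hs e he x hx

/-- A cut with nothing to keep on its left, whose kept right part `c₃` is followed by an entry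
larger than it. -/
theorem HasLabel.capped_of_cut (hl : l = pre ++ (c₁ ++ (c₃ ++ c₄)) ++ suf)
    (hN : ∀ e ∈ l, e < l.length) (h : IsCore pre (c₁ ++ (c₃ ++ c₄)) suf)
    (h₃ : c₃.Pairwise (· < ·)) (hj : c₃.length = j + 1)
    (h₁ : ∀ p e, c₁ = p ++ [e] → ∃ e' ∈ c₃ ++ c₄ ++ suf, e < e')
    (h₄ : ∀ e q, c₄ = e :: q → ∃ e' ∈ c₃, e < e')
    (hs : ∃ x ∈ c₄ ++ suf, ∀ e ∈ c₃, e < x) :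
    HasLabel (insertMax l (pre.length + c₁.length)) (.capped 0 j) := by
  refine .capped (pre := pre ++ c₁) (lo := [l.length]) (mi := c₃) (suf := c₄ ++ suf) ?_
    (IsCore.insert (c₂ := []) (by simpa using h) (by simpa [hl] using hN) h₃ (by simp) h₁ h₄)
    rfl hj (by simp) h₃ ?_ ?_ hs
  · have := insertMax_append (pre ++ c₁) (c₃ ++ c₄ ++ suf)
    simpa [hl] using this
  · simp only [List.mem_singleton, forall_eq]
    intro x hx
    apply hN; rw [hl]; simp; tauto
  · simp only [List.mem_singleton, forall_eq]
    intro x hx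
    apply hN; rw [hl]; simp at hx ⊢; tauto

end Children

/-- The second length is written in the form in which it appears after reflecting the summation
index `i` in `i < n`. -/
theorem exists_cut {c : List ℕ} {i n : ℕ} (hc : c.length = n) (hi : i < n) :
    ∃ c₁ c₂, c = c₁ ++ c₂ ∧ c₁.length = i ∧ c₂.length = (n - 1 - i) + 1 :=
  ⟨c.take i, c.drop i, (List.take_append_drop i c).symm, by simp; omega, by simp; omega⟩

theorem exists_eq_concat_of_append_eq {u c p : List ℕ} {e : ℕ} (hc : c ≠ [])
    (h : u ++ c = p ++ [e]) : ∃ p', c = p' ++ [e] := by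
  obtain ⟨p', e₁, rfl⟩ := (List.eq_nil_or_concat' c).resolve_left hc
  rw [← List.append_assoc] at h
  exact ⟨p', by rw [(List.append_inj' h rfl).2]⟩

theorem lt_of_pairwise_append {p c₂ : List ℕ} {e : ℕ} (h : (p ++ [e] ++ c₂).Pairwise (· < ·))
    (hc : c₂ ≠ []) : ∃ e' ∈ c₂, e < e' := by
  obtain ⟨x, t, rfl⟩ := List.exists_cons_of_ne_nil hc
  refine ⟨x, by simp, ?_⟩
  rw [List.pairwise_append] at h
  exact h.2.2 e (by simp) x (by simp)

open Classical in
theorem IsCore.sum_sites {M : Type*} [AddCommMonoid M] {l pre c suf : List ℕ}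
    (hl : l = pre ++ c ++ suf) (h : IsCore pre c suf) (hav : Avoids l) (hN : ∀ e ∈ l, e < l.length)
    (g : List ℕ → M) :
    ∑ i ∈ Finset.range (l.length + 1),
      (if Avoids (insertMax l i) then g (insertMax l i) else 0) =
    ∑ i ∈ Finset.range (c.length + 1), g (insertMax l (pre.length + i)) := by
  have hlen : l.length + 1 = pre.length + (c.length + 1) + suf.length := by
    rw [hl]; simp; omega
  have hact : ∀ i < l.length + 1, (Avoids (insertMax l i) ↔
      pre.length ≤ i ∧ i ≤ pre.length + c.length) := by
    intro i hi
    rw [avoids_insertMax_iff hN, ← h.active_iff (i := i) (by rw [← hl]; omega), ← hl]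
    simp [hav]
  rw [hlen, Finset.sum_range_add, Finset.sum_range_add,
    Finset.sum_eq_zero (s := Finset.range pre.length),
    Finset.sum_eq_zero (s := Finset.range suf.length), zero_add, add_zero]
  · refine Finset.sum_congr rfl fun i hi => ?_
    rw [Finset.mem_range] at hi
    rw [if_pos ((hact _ (by omega)).2 (by omega))]
  · intro i hi
    rw [Finset.mem_range] at hi
    rw [if_neg (mt (hact _ (by omega)).1 (by omega))]
  · intro i hi
    rw [Finset.mem_range] at hi
    rw [if_neg (mt (hact _ (by omega)).1 (by omega))]

theorem sum_eq_of_reflect {M : Type*} [AddCommMonoid M] {n : ℕ} {f g : ℕ → M}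
    (h : ∀ i < n, f i = g (n - 1 - i)) :
    ∑ i ∈ Finset.range n, f i = ∑ i ∈ Finset.range n, g i := by
  rw [← Finset.sum_range_reflect g n]
  exact Finset.sum_congr rfl fun i hi => h i (Finset.mem_range.1 hi)

open Classical in
/-- The labels of the children of a list in the generating tree depend only on its own label. -/
theorem HasLabel.sum_children {M : Type*} [AddCommMonoid M] {l : List ℕ} {s : Label}
    (h : HasLabel l s) (hav : Avoids l) (hN : ∀ e ∈ l, e < l.length)
    {g : List ℕ → M} {g' : Label → M}
    (hg : ∀ i s', HasLabel (insertMax l i) s' → Avoids (insertMax l i) →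
      g (insertMax l i) = g' s') :
    ∑ i ∈ Finset.range (l.length + 1),
      (if Avoids (insertMax l i) then g (insertMax l i) else 0) = s.childSum g' := by
  have hgen : ∀ {pre c suf : List ℕ}, l = pre ++ c ++ suf → IsCore pre c suf → ∀ i ≤ c.length,
      ∀ s', HasLabel (insertMax l (pre.length + i)) s' →
        g (insertMax l (pre.length + i)) = g' s' := by
    intro pre c suf hl core i hi s' h'
    refine hg _ s' h' ((avoids_insertMax_iff hN _).2 ⟨hav, ?_⟩)
    rw [hl]
    exact (core.active_iff (by simp; omega)).2 (by omega)
  cases h with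
  | @high pre lo hi suf p a hl core hi_len lo_len lo_lt hi_lt suf_lt split =>
    have hg' := hgen hl core
    rw [List.length_append, lo_len, hi_len] at hg'
    rw [core.sum_sites hl hav hN, List.length_append, lo_len, hi_len, Finset.sum_range_succ,
      Finset.sum_range_add]
    simp only [Label.childSum]
    congr 1
    · congr 1
      -- In a cut inside the first run, the second run is cut off and becomes the cap.
      · refine sum_eq_of_reflect fun i hi' => hg' _ (by omega) _ ?_
        obtain ⟨c₁, c₂, rfl, rfl, hc₂⟩ := exists_cut lo_len hi'
        have hc₂' : c₂ ≠ [] := List.ne_nil_of_length_eq_add_one hc₂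
        obtain ⟨b, t, rfl, hb, x, hx, hxlo⟩ := split (by simp [hc₂'])
        refine .capped_of_cut (c₃ := c₂) (c₄ := b :: t) (suf := suf) (by simp [hl]) hN
          (by simpa using core) (List.pairwise_append.1 lo_lt).2.1 hc₂ ?_ ?_ ?_
        · rintro p e rfl
          obtain ⟨e', he', hlt⟩ := lt_of_pairwise_append lo_lt hc₂'
          exact ⟨e', by simp [he'], hlt⟩
        · intro e q he
          obtain ⟨rfl, rfl⟩ := List.cons.inj he
          obtain ⟨e', he'⟩ := List.exists_mem_of_ne_nil _ hc₂'
          exact ⟨e', he', hb e' (by simp [he'])⟩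
        · exact ⟨x, by simp [hx], fun e he => hxlo e (by simp [he])⟩
      -- In a cut inside the second run, only the part of that run on the right is kept.
      · refine sum_eq_of_reflect fun i hi' => hg' _ (by omega) _ ?_
        obtain ⟨c₁, c₂, rfl, rfl, hc₂⟩ := exists_cut hi_len hi'
        have hc₂' : c₂ ≠ [] := List.ne_nil_of_length_eq_add_one hc₂
        rw [← lo_len, ← List.length_append]
        refine .low_of_cut (c₁ := lo ++ c₁) (c₃ := c₂) (c₄ := []) (suf := suf) (by simp [hl]) hN
          (by simpa using core) (List.pairwise_append.1 hi_lt).2.1 hc₂ ?_ (by simp) ?_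
        · intro p e hp
          rcases eq_or_ne c₁ [] with rfl | hc₁
          · obtain ⟨b, t, hbt, hb, x, hx, hxlo⟩ := split (by rintro rfl; simp at hp)
            refine ⟨x, ?_, hxlo e ?_⟩
            · simp at hbt; simp [hbt, hx]
            · simp at hp; simp [hp]
          · obtain ⟨p', rfl⟩ := exists_eq_concat_of_append_eq hc₁ hp
            obtain ⟨e', he', hlt⟩ := lt_of_pairwise_append hi_lt hc₂'
            exact ⟨e', by simp [he'], hlt⟩
        · intro e he x hx
          exact suf_lt e (by simp [he]) x (by simpa using hx)
    -- At the right end of the core nothing is cut off.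
    · refine hg' _ le_rfl _ ?_
      have hlN : ∀ e ∈ lo ++ hi ++ suf, e < l.length := fun e he =>
        hN e (by rw [hl]; simp at he ⊢; tauto)
      refine .high (pre := pre) (lo := lo) (hi := hi ++ [l.length]) (suf := suf) ?_ ?_ (by simp [hi_len])
        lo_len lo_lt ?_ ?_ ?_
      · have := insertMax_append (pre ++ (lo ++ hi)) suf
        simpa [hl, lo_len, hi_len] using this
      · have := IsCore.insert (pre := pre) (suf := suf) (c₁ := []) (c₂ := lo ++ hi) (c₃ := [])
          (c₄ := []) (N := l.length) (by simpa using core) (by simpa [hl] using hN) (by simp)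
          (by simpa using suf_lt) (by simp) (by simp)
        simpa using this
      · rw [List.pairwise_append]
        exact ⟨hi_lt, by simp, fun e he x hx => by
          rw [List.mem_singleton.1 hx]; exact hlN e (by simp [he])⟩
      · intro e he x hx
        rw [← List.append_assoc, List.mem_append] at he
        rcases he with he | he
        · exact suf_lt e he x hx
        · rw [List.mem_singleton.1 he]; exact hlN x (by simp [hx])
      · intro hlo
        obtain ⟨b, t, rfl, hb, x, hx, hxlo⟩ := split hlo
        exact ⟨b, t ++ [l.length], by simp, hb, x, by simp [hx], hxlo⟩
  | @low pre lo mi suf a m hl core lo_len mi_len lo_lt mi_lt mi_lt_lo suf_lt =>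
    have hg' := hgen hl core
    rw [List.length_append, lo_len, mi_len] at hg'
    have mi_ne : mi ≠ [] := List.ne_nil_of_length_eq_add_one mi_len
    have hlN : ∀ e ∈ lo ++ mi ++ suf, e < l.length := fun e he =>
      hN e (by rw [hl]; simp at he ⊢; tauto)
    rw [core.sum_sites hl hav hN, List.length_append, lo_len, mi_len, Finset.sum_range_succ,
      ← add_assoc (a + 1) m 1, add_right_comm (a + 1) m 1, Finset.sum_range_add,
      Finset.sum_range_succ]
    simp only [Label.childSum]
    congr 1
    · congr 1
      · congr 1
        -- In a cut inside the first run, only the part of that run on the right is kept.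
        · refine sum_eq_of_reflect fun i hi => hg' _ (by omega) _ ?_
          obtain ⟨c₁, c₂, rfl, rfl, hc₂⟩ := exists_cut lo_len hi
          have hc₂' : c₂ ≠ [] := List.ne_nil_of_length_eq_add_one hc₂
          refine .low_of_cut (c₃ := c₂) (c₄ := mi) (suf := suf) (by simp [hl]) hN
            (by simpa using core) (List.pairwise_append.1 lo_lt).2.1 hc₂ ?_ ?_ ?_
          · rintro p e rfl
            obtain ⟨e', he', hlt⟩ := lt_of_pairwise_append lo_lt hc₂'
            exact ⟨e', by simp [he'], hlt⟩
          · rintro e q rfl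
            obtain ⟨e', he'⟩ := List.exists_mem_of_ne_nil _ hc₂'
            exact ⟨e', he', mi_lt_lo e' (by simp [he']) e (by simp)⟩
          · intro e he x hx
            rcases List.mem_append.1 hx with hx | hx
            · exact mi_lt_lo e (by simp [he]) x hx
            · exact suf_lt e (by simp [he]) x hx
        -- Between the runs, the new maximum extends the first run.
        · refine hg' _ (by omega) _ ?_
          refine .low (pre := pre) (lo := lo ++ [l.length]) (mi := mi) (suf := suf) ?_ ?_
            (by simp [lo_len]) mi_len ?_ mi_lt ?_ ?_
          · have := insertMax_append (pre ++ lo) (mi ++ suf)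
            simpa [hl, lo_len] using this
          · have := IsCore.insert (pre := pre) (suf := suf) (c₁ := []) (c₂ := lo) (c₃ := mi)
              (c₄ := []) (N := l.length) (by simpa using core) (by simpa [hl] using hN) mi_lt
              (fun e he x hx => (List.mem_append.1 hx).elim
                (fun hx => mi_lt_lo e he x (by simpa using hx)) (suf_lt e (by simp [he]) x))
              (by simp) (by simp)
            simpa using this
          · rw [List.pairwise_append]
            exact ⟨lo_lt, by simp, fun e he x hx => by
              rw [List.mem_singleton.1 hx]; exact hlN e (by simp [he])⟩
          · intro e he x hx
            rcases List.mem_append.1 he with he | he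
            · exact mi_lt_lo e he x hx
            · rw [List.mem_singleton.1 he]; exact hlN x (by simp [hx])
          · intro e he x hx
            by_cases he' : e = l.length
            · rw [he']; exact hlN x (by simp [hx])
            · exact suf_lt e (by simp [he'] at he ⊢; tauto) x hx
      -- In a cut inside the second run, the first run is cut off.
      · refine sum_eq_of_reflect fun i hi => hg' _ (by omega) _ ?_
        obtain ⟨c₁, c₂, rfl, hc₁, hc₂⟩ := exists_cut (i := i + 1) mi_len (by omega)
        have hc₂' : c₂ ≠ [] := List.ne_nil_of_length_eq_add_one hc₂
        have hi' : a + 1 + 1 + i = (lo ++ c₁).length := by simp [lo_len, hc₁]; omega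
        rw [hi']
        refine .low_of_cut (c₁ := lo ++ c₁) (c₃ := c₂) (c₄ := []) (suf := suf) (by simp [hl]) hN
          (by simpa using core) (List.pairwise_append.1 mi_lt).2.1 (by omega) ?_ (by simp) ?_
        · intro p e hp
          obtain ⟨p', rfl⟩ := exists_eq_concat_of_append_eq
            (List.ne_nil_of_length_eq_add_one hc₁) hp
          obtain ⟨e', he', hlt⟩ := lt_of_pairwise_append mi_lt hc₂'
          exact ⟨e', by simp [he'], hlt⟩
        · intro e he x hx
          exact suf_lt e (by simp [he]) x (by simpa using hx)
    -- At the right end of the core nothing is cut off.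
    · have hi' : a + 1 + 1 + m = (lo ++ mi).length := by simp [lo_len, mi_len]; omega
      refine hg' _ (by omega) _ ?_
      rw [hi']
      refine .high (pre := pre) (lo := lo) (hi := mi ++ [l.length]) (suf := suf) ?_ ?_
        (by simp [mi_len]) lo_len lo_lt ?_ ?_ ?_
      · have := insertMax_append (pre ++ (lo ++ mi)) suf
        simpa [hl] using this
      · have := IsCore.insert (pre := pre) (suf := suf) (c₁ := []) (c₂ := lo ++ mi) (c₃ := [])
          (c₄ := []) (N := l.length) (by simpa using core) (by simpa [hl] using hN) (by simp)
          (by simpa using suf_lt) (by simp) (by simp)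
        simpa using this
      · rw [List.pairwise_append]
        exact ⟨mi_lt, by simp, fun e he x hx => by
          rw [List.mem_singleton.1 hx]; exact hlN e (by simp [he])⟩
      · intro e he x hx
        rw [← List.append_assoc, List.mem_append] at he
        rcases he with he | he
        · exact suf_lt e he x hx
        · rw [List.mem_singleton.1 he]; exact hlN x (by simp [hx])
      · intro _
        obtain ⟨b, t, rfl⟩ := List.exists_cons_of_ne_nil mi_ne
        exact ⟨b, t ++ [l.length], by simp, fun e he => mi_lt_lo e he b (by simp), l.length,
          by simp, fun e he => hlN e (by simp [he])⟩
  | @capped pre lo mi suf a m hl core lo_len mi_len lo_lt mi_lt mi_lt_lo suf_lt cap =>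
    have hg' := hgen hl core
    rw [List.length_append, lo_len, mi_len] at hg'
    have mi_ne : mi ≠ [] := List.ne_nil_of_length_eq_add_one mi_len
    have hlN : ∀ e ∈ lo ++ mi ++ suf, e < l.length := fun e he =>
      hN e (by rw [hl]; simp at he ⊢; tauto)
    rw [core.sum_sites hl hav hN, List.length_append, lo_len, mi_len, Finset.sum_range_succ,
      ← add_assoc (a + 1) m 1, add_right_comm (a + 1) m 1, Finset.sum_range_add,
      Finset.sum_range_succ]
    simp only [Label.childSum]
    congr 1
    · congr 1
      · congr 1
        -- In a cut inside the first run, only the part of that run on the right is kept.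
        · refine sum_eq_of_reflect fun i hi => hg' _ (by omega) _ ?_
          obtain ⟨c₁, c₂, rfl, rfl, hc₂⟩ := exists_cut lo_len hi
          have hc₂' : c₂ ≠ [] := List.ne_nil_of_length_eq_add_one hc₂
          refine .low_of_cut (c₃ := c₂) (c₄ := mi) (suf := suf) (by simp [hl]) hN
            (by simpa using core) (List.pairwise_append.1 lo_lt).2.1 hc₂ ?_ ?_ ?_
          · rintro p e rfl
            obtain ⟨e', he', hlt⟩ := lt_of_pairwise_append lo_lt hc₂'
            exact ⟨e', by simp [he'], hlt⟩
          · rintro e q rfl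
            obtain ⟨e', he'⟩ := List.exists_mem_of_ne_nil _ hc₂'
            exact ⟨e', he', mi_lt_lo e' (by simp [he']) e (by simp)⟩
          · intro e he x hx
            rcases List.mem_append.1 hx with hx | hx
            · exact mi_lt_lo e (by simp [he]) x hx
            · exact suf_lt e (by simp [he]) x hx
        -- Between the runs, the new maximum extends the first run.
        · refine hg' _ (by omega) _ ?_
          refine .capped (pre := pre) (lo := lo ++ [l.length]) (mi := mi) (suf := suf) ?_ ?_
            (by simp [lo_len]) mi_len ?_ mi_lt ?_ ?_ cap
          · have := insertMax_append (pre ++ lo) (mi ++ suf)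
            simpa [hl, lo_len] using this
          · have := IsCore.insert (pre := pre) (suf := suf) (c₁ := []) (c₂ := lo) (c₃ := mi)
              (c₄ := []) (N := l.length) (by simpa using core) (by simpa [hl] using hN) mi_lt
              (fun e he x hx => (List.mem_append.1 hx).elim
                (fun hx => mi_lt_lo e he x (by simpa using hx)) (suf_lt e (by simp [he]) x))
              (by simp) (by simp)
            simpa using this
          · rw [List.pairwise_append]
            exact ⟨lo_lt, by simp, fun e he x hx => by
              rw [List.mem_singleton.1 hx]; exact hlN e (by simp [he])⟩
          · intro e he x hx
            rcases List.mem_append.1 he with he | he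
            · exact mi_lt_lo e he x hx
            · rw [List.mem_singleton.1 he]; exact hlN x (by simp [hx])
          · intro e he x hx
            by_cases he' : e = l.length
            · rw [he']; exact hlN x (by simp [hx])
            · exact suf_lt e (by simp [he'] at he ⊢; tauto) x hx
      -- In a cut inside the second run, the first run is cut off.
      · refine sum_eq_of_reflect fun i hi => hg' _ (by omega) _ ?_
        obtain ⟨c₁, c₂, rfl, hc₁, hc₂⟩ := exists_cut (i := i + 1) mi_len (by omega)
        have hc₂' : c₂ ≠ [] := List.ne_nil_of_length_eq_add_one hc₂
        have hi' : a + 1 + 1 + i = (lo ++ c₁).length := by simp [lo_len, hc₁]; omega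
        rw [hi']
        refine .capped_of_cut (c₁ := lo ++ c₁) (c₃ := c₂) (c₄ := []) (suf := suf) (by simp [hl]) hN
          (by simpa using core) (List.pairwise_append.1 mi_lt).2.1 (by omega) ?_ (by simp) ?_
        · intro p e hp
          obtain ⟨p', rfl⟩ := exists_eq_concat_of_append_eq
            (List.ne_nil_of_length_eq_add_one hc₁) hp
          obtain ⟨e', he', hlt⟩ := lt_of_pairwise_append mi_lt hc₂'
          exact ⟨e', by simp [he'], hlt⟩
        · obtain ⟨x, hx, hcap⟩ := cap
          exact ⟨x, by simpa using hx, fun e he => hcap e (by simp [he])⟩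
    -- At the right end of the core the cap cuts off both runs.
    · have hi' : a + 1 + 1 + m = (lo ++ mi).length := by simp [lo_len, mi_len]; omega
      refine hg' _ (by omega) _ ?_
      rw [hi']
      refine .high (pre := pre ++ (lo ++ mi)) (lo := []) (hi := [l.length]) (suf := suf) ?_ ?_
        rfl rfl (by simp) (by simp) ?_ (by simp)
      · have := insertMax_append (pre ++ (lo ++ mi)) suf
        simpa [hl] using this
      · have := IsCore.insert (pre := pre) (suf := suf) (c₁ := lo ++ mi) (c₂ := []) (c₃ := [])
          (c₄ := []) (N := l.length) (by simpa using core) (by simpa [hl] using hN) (by simp)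
          (by simp) ?_ (by simp)
        · simpa using this
        · intro p e hp
          obtain ⟨x, hx, hcap⟩ := cap
          refine ⟨x, by simpa using hx, hcap e ?_⟩
          obtain ⟨p', rfl⟩ := exists_eq_concat_of_append_eq mi_ne hp
          simp
      · simp only [List.nil_append, List.mem_singleton, forall_eq]
        exact fun x hx => hlN x (by simp [hx])

/-! ### Counting the nodes of the generating tree -/

open Classical in
/-- The number of lists that arise from `l` by `m` successive insertions of a new maximum, each
of which yields a list that avoids the patterns. -/
noncomputable def numDesc : ℕ → List ℕ → ℕ
  | 0, _ => 1
  | m + 1, l => ∑ i ∈ Finset.range (l.length + 1),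
      if Avoids (insertMax l i) then numDesc m (insertMax l i) else 0

theorem lt_length_insertMax {l : List ℕ} (hN : ∀ e ∈ l, e < l.length) (i : ℕ) :
    ∀ e ∈ insertMax l i, e < (insertMax l i).length := by
  intro e he
  rw [length_insertMax]
  rcases List.mem_cons.1 ((insertMax_perm l i).mem_iff.1 he) with rfl | he
  · omega
  · have := hN e he; omega

theorem Label.map_childSum {M M' F : Type*} [AddCommMonoid M] [AddCommMonoid M'] [FunLike F M M']
    [AddMonoidHomClass F M M'] (φ : F) (g : Label → M) (s : Label) :
    φ (s.childSum g) = s.childSum fun s' => φ (g s') := by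
  cases s <;> simp [childSum, map_sum]

/-- The system of the generating tree determines its solution, which counts descendants. -/
theorem numDesc_eq_coeff {G : Label → ℚ⟦X⟧}
    (hG : ∀ s, G s = 1 + PowerSeries.X * s.childSum G) (m : ℕ) :
    ∀ {l : List ℕ} {s : Label}, HasLabel l s → Avoids l → (∀ e ∈ l, e < l.length) →
      (numDesc m l : ℚ) = PowerSeries.coeff m (G s) := by
  induction m with
  | zero =>
    intro l s _ _ _
    rw [hG s]
    simp [numDesc]
  | succ m ih =>
    intro l s hs hav hN
    rw [hG s, map_add, PowerSeries.coeff_succ_X_mul, PowerSeries.coeff_one, if_neg m.succ_ne_zero,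
      zero_add, Label.map_childSum, ← hs.sum_children (g := fun l => (numDesc m l : ℚ)) hav hN
      (fun i s' h h' => ih h h' (lt_length_insertMax hN i)), numDesc]
    push_cast
    rfl

open Classical in
/-- The permutations of `0, …, n - 1`, as lists, that avoid the patterns. -/
noncomputable def avoiders (n : ℕ) : Finset (List ℕ) :=
  (List.range n).permutations.toFinset.filter Avoids

theorem mem_avoiders {n : ℕ} {l : List ℕ} : l ∈ avoiders n ↔ l ~ List.range n ∧ Avoids l := by
  simp [avoiders, List.mem_permutations]

theorem length_of_mem_avoiders {n : ℕ} {l : List ℕ} (h : l ∈ avoiders n) : l.length = n := by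
  simpa using (mem_avoiders.1 h).1.length_eq

theorem lt_of_mem_avoiders {n : ℕ} {l : List ℕ} (h : l ∈ avoiders n) {e : ℕ} (he : e ∈ l) :
    e < n := by
  simpa using (mem_avoiders.1 h).1.mem_iff.1 he

theorem insertMax_mem_avoiders_iff {n : ℕ} {l : List ℕ} (hl : l ∈ avoiders n) (i : ℕ) :
    insertMax l i ∈ avoiders (n + 1) ↔ Avoids (insertMax l i) := by
  rw [mem_avoiders, and_iff_right_iff_imp]
  intro _
  rw [List.range_succ]
  refine (insertMax_perm l i).trans ?_
  rw [length_of_mem_avoiders hl]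
  exact ((mem_avoiders.1 hl).1.cons n).trans (List.perm_append_singleton n _).symm

open Classical in
/-- Every avoiding list of length `n + 1` arises exactly once from an avoiding list of length `n` by
an insertion of the new maximum. -/
theorem sum_avoiders_succ {M : Type*} [AddCommMonoid M] (n : ℕ) (g : List ℕ → M) :
    ∑ l ∈ avoiders (n + 1), g l = ∑ l ∈ avoiders n, ∑ i ∈ Finset.range (l.length + 1),
      if Avoids (insertMax l i) then g (insertMax l i) else 0 := by
  simp_rw [← Finset.sum_filter]
  rw [Finset.sum_sigma']
  symm
  have hnot : ∀ {l}, l ∈ avoiders n → n ∉ l := fun hl h => (lt_of_mem_avoiders hl h).false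
  refine Finset.sum_bij (fun x _ => insertMax x.1 x.2) ?_ ?_ ?_ fun _ _ => rfl
  · rintro ⟨l, i⟩ h
    simp only [Finset.mem_sigma, Finset.mem_filter] at h
    exact (insertMax_mem_avoiders_iff h.1 i).2 h.2.2
  · rintro ⟨l, i⟩ h ⟨l', i'⟩ h' heq
    simp only [Finset.mem_sigma, Finset.mem_filter, Finset.mem_range] at h h'
    simp only [insertMax, length_of_mem_avoiders h.1, length_of_mem_avoiders h'.1] at heq h h'
    have hn : n ∉ l.take i := fun h'' => hnot h.1 (List.mem_of_mem_take h'')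
    have hn' : n ∉ l'.take i' := fun h'' => hnot h'.1 (List.mem_of_mem_take h'')
    have hi := congrArg (List.idxOf n) heq
    simp only [List.idxOf_append, hn, hn', if_false, List.idxOf_cons_self, zero_add,
      List.length_take, length_of_mem_avoiders h.1, length_of_mem_avoiders h'.1] at hi
    have hl := congrArg (fun t => List.erase t n) heq
    simp only [List.erase_append_right _ hn, List.erase_append_right _ hn', List.erase_cons_head,
      List.take_append_drop] at hl
    subst hl
    obtain rfl : i = i' := by omega
    rfl
  · intro l hl
    have hmem : n ∈ l := (mem_avoiders.1 hl).1.mem_iff.2 (by simp)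
    obtain ⟨u, x, rfl⟩ := List.append_of_mem hmem
    have hp : u ++ x ~ List.range n := by
      have h1 := (mem_avoiders.1 hl).1
      rw [List.range_succ] at h1
      exact (List.perm_cons n).1
        ((List.perm_middle.symm.trans h1).trans (List.perm_append_singleton n _))
    have hlen : (u ++ x).length = n := by simpa using hp.length_eq
    have hav := (mem_avoiders.1 hl).2
    have hav' := (avoids_insert_iff (fun e he => by simpa using hp.mem_iff.1 he)).1 hav
    have hins : insertMax (u ++ x) u.length = u ++ n :: x := by rw [insertMax_append, hlen]
    refine ⟨⟨u ++ x, u.length⟩, ?_, hins⟩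
    simp only [Finset.mem_sigma, Finset.mem_filter, Finset.mem_range]
    exact ⟨mem_avoiders.2 ⟨hp, hav'.1⟩, by simp, by rw [hins]; exact hav⟩

theorem card_avoiders_add (n m : ℕ) : (avoiders (n + m)).card = ∑ l ∈ avoiders n, numDesc m l := by
  induction m generalizing n with
  | zero => simp [numDesc]
  | succ m ih =>
    rw [← add_assoc, add_right_comm, ih, sum_avoiders_succ]
    rfl

theorem avoids_nil : Avoids [] := fun a b c d _ _ _ => by simp

theorem card_avoiders (n : ℕ) : (avoiders n).card = numDesc n [] := by
  have h : avoiders 0 = {[]} := by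
    ext l
    simp only [mem_avoiders, List.range_zero, List.perm_nil, Finset.mem_singleton,
      and_iff_left_iff_imp]
    rintro rfl
    exact avoids_nil
  rw [← zero_add n, card_avoiders_add, h, Finset.sum_singleton, zero_add]

/-! ### From permutations to lists -/

theorem four_sublist_ofFn_iff {α : Type*} {n : ℕ} {f : Fin n → α} {x₀ x₁ x₂ x₃ : α} :
    [x₀, x₁, x₂, x₃] <+ List.ofFn f ↔ ∃ v₀ v₁ v₂ v₃, v₀ < v₁ ∧ v₁ < v₂ ∧ v₂ < v₃ ∧
      f v₀ = x₀ ∧ f v₁ = x₁ ∧ f v₂ = x₂ ∧ f v₃ = x₃ := by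
  rw [List.ofFn_eq_map]
  constructor
  · intro h
    obtain ⟨l, hl, he⟩ := List.sublist_map_iff.1 h
    have hs := (List.sortedLT_finRange n).pairwise.sublist hl
    obtain ⟨v₀, v₁, v₂, v₃, rfl⟩ : ∃ v₀ v₁ v₂ v₃, l = [v₀, v₁, v₂, v₃] :=
      List.length_eq_four.1 (by simpa using (congrArg List.length he).symm)
    simp at he hs
    exact ⟨v₀, v₁, v₂, v₃, hs.1.1, hs.2.1.1, hs.2.2, by tauto⟩
  · rintro ⟨v₀, v₁, v₂, v₃, h₁, h₂, h₃, rfl, rfl, rfl, rfl⟩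
    have hs : [v₀, v₁, v₂, v₃].Pairwise (· < ·) := by
      simp [h₁, h₂, h₃, h₁.trans h₂, h₂.trans h₃, (h₁.trans h₂).trans h₃]
    refine List.Sublist.map (l₁ := [v₀, v₁, v₂, v₃]) f ?_
    exact List.sublist_of_subperm_of_sortedLE
      (List.subperm_of_subset (hs.imp ne_of_lt) fun v _ => List.mem_finRange v)
      (hs.imp le_of_lt).sortedLE (List.sortedLT_finRange n).sortedLE

theorem contains_p4123_iff {n : ℕ} {σ : Equiv.Perm (Fin n)} :
    Contains σ p4123 ↔ ∃ v₀ v₁ v₂ v₃ : Fin n, v₀ < v₁ ∧ v₁ < v₂ ∧ v₂ < v₃ ∧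
      σ.symm v₃ < σ.symm v₀ ∧ σ.symm v₀ < σ.symm v₁ ∧ σ.symm v₁ < σ.symm v₂ := by
  constructor
  · rintro ⟨f, hf, h⟩
    refine ⟨σ (f 1), σ (f 2), σ (f 3), σ (f 0), (h 1 2).2 (by decide), (h 2 3).2 (by decide),
      (h 3 0).2 (by decide), ?_⟩
    simp only [Equiv.symm_apply_apply]
    exact ⟨hf (by decide), hf (by decide), hf (by decide)⟩
  · rintro ⟨v₀, v₁, v₂, v₃, h₁, h₂, h₃, h₄, h₅, h₆⟩
    refine ⟨![σ.symm v₃, σ.symm v₀, σ.symm v₁, σ.symm v₂], ?_, ?_⟩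
    · rw [Fin.strictMono_iff_lt_succ]
      intro i
      fin_cases i <;> simpa
    · intro i j
      fin_cases i <;> fin_cases j <;> simp [p4123] <;> omega

theorem contains_p1342_iff {n : ℕ} {σ : Equiv.Perm (Fin n)} :
    Contains σ p1342 ↔ ∃ v₀ v₁ v₂ v₃ : Fin n, v₀ < v₁ ∧ v₁ < v₂ ∧ v₂ < v₃ ∧
      σ.symm v₀ < σ.symm v₂ ∧ σ.symm v₂ < σ.symm v₃ ∧ σ.symm v₃ < σ.symm v₁ := by
  constructor
  · rintro ⟨f, hf, h⟩
    refine ⟨σ (f 0), σ (f 3), σ (f 1), σ (f 2), (h 0 3).2 (by decide), (h 3 1).2 (by decide),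
      (h 1 2).2 (by decide), ?_⟩
    simp only [Equiv.symm_apply_apply]
    exact ⟨hf (by decide), hf (by decide), hf (by decide)⟩
  · rintro ⟨v₀, v₁, v₂, v₃, h₁, h₂, h₃, h₄, h₅, h₆⟩
    refine ⟨![σ.symm v₀, σ.symm v₂, σ.symm v₃, σ.symm v₁], ?_, ?_⟩
    · rw [Fin.strictMono_iff_lt_succ]
      intro i
      fin_cases i <;> simpa
    · intro i j
      fin_cases i <;> fin_cases j <;> simp [p1342] <;> omega

/-- The list whose entry at index `v` is the position of the value `v` in `σ`, counted from the right
end. -/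
def revInvList {n : ℕ} (σ : Equiv.Perm (Fin n)) : List ℕ :=
  List.ofFn fun v => ((σ.symm v).rev : ℕ)

theorem avoids_revInvList_iff {n : ℕ} {σ : Equiv.Perm (Fin n)} :
    Avoids (revInvList σ) ↔ σ ∈ Av {⟨4, p4123⟩, ⟨4, p1342⟩} n := by
  simp only [Av, Set.mem_ofPred_eq, Set.mem_insert_iff, Set.mem_singleton_iff, forall_eq_or_imp,
    forall_eq, contains_p4123_iff, contains_p1342_iff]
  simp only [Avoids, revInvList, four_sublist_ofFn_iff]
  constructor
  · intro h
    constructor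
    · rintro ⟨v₀, v₁, v₂, v₃, h₁, h₂, h₃, h₄, h₅, h₆⟩
      exact (h _ _ _ _ (Fin.rev_lt_rev.2 h₆) (Fin.rev_lt_rev.2 h₅) (Fin.rev_lt_rev.2 h₄)).1
        ⟨v₀, v₁, v₂, v₃, h₁, h₂, h₃, rfl, rfl, rfl, rfl⟩
    · rintro ⟨v₀, v₁, v₂, v₃, h₁, h₂, h₃, h₄, h₅, h₆⟩
      exact (h _ _ _ _ (Fin.rev_lt_rev.2 h₆) (Fin.rev_lt_rev.2 h₅) (Fin.rev_lt_rev.2 h₄)).2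
        ⟨v₀, v₁, v₂, v₃, h₁, h₂, h₃, rfl, rfl, rfl, rfl⟩
  · rintro ⟨h, h'⟩ a b c d hab hbc hcd
    constructor
    · rintro ⟨v₀, v₁, v₂, v₃, h₁, h₂, h₃, rfl, rfl, rfl, rfl⟩
      exact h ⟨v₀, v₁, v₂, v₃, h₁, h₂, h₃, Fin.rev_lt_rev.1 hcd, Fin.rev_lt_rev.1 hbc,
        Fin.rev_lt_rev.1 hab⟩
    · rintro ⟨v₀, v₁, v₂, v₃, h₁, h₂, h₃, rfl, rfl, rfl, rfl⟩
      exact h' ⟨v₀, v₁, v₂, v₃, h₁, h₂, h₃, Fin.rev_lt_rev.1 hcd, Fin.rev_lt_rev.1 hbc,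
        Fin.rev_lt_rev.1 hab⟩

theorem revInvList_injective {n : ℕ} :
    Function.Injective (revInvList : Equiv.Perm (Fin n) → List ℕ) := by
  intro σ τ h
  have h := List.ofFn_injective h
  rw [← Equiv.symm_symm σ, ← Equiv.symm_symm τ]
  congr 1
  ext v
  exact congrArg Fin.val <| by simpa using Fin.rev_injective (Fin.val_injective (congrFun h v))

theorem exists_revInvList_eq_iff {n : ℕ} {l : List ℕ} :
    (∃ σ : Equiv.Perm (Fin n), revInvList σ = l) ↔ l ~ List.range n := by
  constructor
  · rintro ⟨σ, rfl⟩
    have h := (Equiv.Perm.map_finRange_perm (σ.symm.trans Fin.revPerm)).map (Fin.val : Fin n → ℕ)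
    rw [List.map_coe_finRange_eq_range, List.map_map] at h
    rwa [revInvList, List.ofFn_eq_map]
  · intro h
    have hlen : l.length = n := by simpa using h.length_eq
    subst hlen
    have hlt : ∀ v : Fin l.length, l.get v < l.length := fun v =>
      List.mem_range.1 (h.mem_iff.1 (List.get_mem l v))
    have hinj : Function.Injective fun v : Fin l.length => (⟨l.get v, hlt v⟩ : Fin l.length).rev := by
      intro v w hvw
      have := Fin.val_eq_of_eq (Fin.rev_injective hvw)
      exact (List.nodup_iff_injective_get.1 (h.nodup_iff.2 List.nodup_range)) this
    refine ⟨(Equiv.ofBijective _ (Finite.injective_iff_bijective.1 hinj)).symm, ?_⟩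
    simp [revInvList]

theorem ncard_Av (n : ℕ) : (Av {⟨4, p4123⟩, ⟨4, p1342⟩} n).ncard = numDesc n [] := by
  rw [← card_avoiders, ← Set.ncard_coe_finset, ← Set.ncard_image_of_injective _ revInvList_injective]
  congr 1
  ext l
  simp only [Set.mem_image, Finset.mem_coe, mem_avoiders, ← exists_revInvList_eq_iff]
  constructor
  · rintro ⟨σ, hσ, rfl⟩
    exact ⟨⟨σ, rfl⟩, avoids_revInvList_iff.2 hσ⟩
  · rintro ⟨⟨σ, rfl⟩, hσ⟩
    exact ⟨σ, avoids_revInvList_iff.1 hσ, rfl⟩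

theorem P₃_eq {G : Label → ℚ⟦X⟧} (hG : ∀ s, G s = 1 + PowerSeries.X * s.childSum G) :
    P₃ = G (.high 0 0) := by
  ext n
  rw [P₃, genFun, PowerSeries.coeff_mk, ncard_Av,
    numDesc_eq_coeff hG n HasLabel.nil avoids_nil (by simp)]

theorem isSqrtOneSubFour_catalanQ : IsSqrtOneSubFour (1 - 2 * PowerSeries.X * catalanQ) :=
  ⟨by linear_combination 4 * PowerSeries.X * X_mul_catalanQ_sq, by simp⟩

end PermClass

theorem theorem3 :
    ∃ s : ℚ⟦X⟧, PermClass.IsSqrtOneSubFour s ∧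
      let z : ℚ⟦X⟧ := PowerSeries.X
      PermClass.P₃ =
        1 + z * (1 - z) * (1 - 2 * z) *
            (1 - 7 * z + 17 * z ^ 2 - 16 * z ^ 3 + 4 * z ^ 4 + (1 - 3 * z + 3 * z ^ 2) * s) *
          (2 - 22 * z + 96 * z ^ 2 - 220 * z ^ 3 + 282 * z ^ 4 - 196 * z ^ 5 + 64 * z ^ 6
            - 8 * z ^ 7)⁻¹ := by
  obtain ⟨G, hG, hG₀⟩ := PermClass.exists_label_genFun
  exact ⟨_, PermClass.isSqrtOneSubFour_catalanQ, (PermClass.P₃_eq hG).trans hG₀⟩
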